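/- Let $\tau_s(x)$, $s\ge 0$, be the polynomials defined by $\sum_{s\ge 0}\frac{\tau_s(x)}{s!}z^s=\bigl((1+z)e^{-z}\bigr)^x$, let $\Delta h(x)=h(x+1)-h(x)$, and let $\Delta^s$ be the $s$-fold iterate of $\Delta$. Let $N\ge 0$ be an integer and let $B,C>0$. There is a constant $K>0$, depending only on $N$, $B$ and $C$, with the following property. Let $T>0$, let $\varphi:[0,\infty)\to\mathbb{R}$ have $N+1$ continuous derivatives on $[0,\infty)$, and let $G$ be a real function, positive on $[T,\infty)$, such that \[ \bigl|\varphi^{(N+1)}(x)\bigr|\le \frac{G(x)}{x^{N+1}}\quad\text{for all }x\ge T, \qquad G(y)\le B\,G(x)\,e^{C|y-x|/\sqrt{x}}\quad\text{for all }x,y\ge T . \] Then the series $\sum_{m\ge 0}\frac{\varphi(m)}{m!}R^m$ converges for every real $R$, and, as $R\to+\infty$, \[ e^{-R}\sum_{m=0}^\infty \frac{\varphi(m)}{m!}R^m =\sum_{s=0}^{N}\frac{\Delta^s \varphi(R)}{s!}\,\tau_{s}(-R) +O\!\left(R^{-\frac{N+1}{2}}G(R)\right) +O\!\left(R^{T+\frac{N+1}{2}}e^{-R}\right),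 \] where both implied constants may be taken equal to $K$; that is, there is an $R_0$ (which may depend on $T,\varphi,G$ as well) such that for all $R\ge R_0$ the difference of the left-hand side and the sum over $s$ is at most $K R^{-\frac{N+1}{2}}G(R)+K R^{T+\frac{N+1}{2}}e^{-R}$ in absolute value. -/

import Mathlib

open Filter Set


noncomputable section

/-- The polynomials `τ_s`, defined by the generating function
`∑_s τ_s(x) z^s / s! = ((1 + z) e^{-z})^x = (1 + z)^x e^{-x z}`
(an identity of formal power series in `z`, for each real `x`). -/
def tau (s : ℕ) (x : ℝ) : ℝ :=
  (s.factorial : ℝ) * PowerSeries.coeff s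
    (PowerSeries.binomialSeries ℝ x * PowerSeries.rescale (-x) (PowerSeries.exp ℝ))

end

/-! The left-hand side is the expectation of `φ(X)` for `X` Poisson with mean `R`. Let `P` be
Newton's interpolant of `φ` at `R, R+1, …, R+N`. Since the expectation of `Ring.choose (X - R) s` is
exactly `τ_s(-R)/s!` (`hasSum_poisson_choose`), the main sum is the expectation of `P(X)`, and only
`φ - P` has to be estimated.

For `m ≥ T`, the error is `Ring.choose (m - R) (N + 1)` times `φ^(N+1)(ξ)` (`exists_newton_error`).
With `t = |m - R|/√R`, the binomial costs `R^((N+1)/2)`, the derivative gives `G(R) R^(-(N+1))`, and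
all other losses are at most a constant times `e^((2+C)t)` (`newton_error_near_le`). Exponential
moments of `t` are bounded uniformly in large `R` (`poisson_exp_abs`).

For `m < T` the derivative is not controlled, but each Poisson weight is at most `R^T e^(-R)`.
Comparison with the fixed interpolant based at `T` (`newton_error_left_le`) leaves a quantity
independent of `R`, plus `G(R) e^(O(√R))` times a power of `R`; these go into the second and the
first error term respectively. -/

lemma HasSum.of_forall_eq {f g : ℕ → ℝ} {a b : ℝ} (h : HasSum f a) (hfg : ∀ m, g m = f m)
    (hab : b = a) : HasSum g b := by
  rwa [hab, funext hfg]

/-! ### Moments of the Poisson distribution. -/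

lemma hasSum_pow_div_factorial (x : ℝ) :
    HasSum (fun m : ℕ => x ^ m / (m.factorial : ℝ)) (Real.exp x) := by
  rw [Real.exp_eq_exp_ℝ]
  exact NormedSpace.expSeries_div_hasSum_exp x

lemma hasSum_pow_div_factorial_mul_choose (R : ℝ) (j : ℕ) :
    HasSum (fun m : ℕ => R ^ m / (m.factorial : ℝ) * (m.choose j : ℝ))
      (R ^ j / (j.factorial : ℝ) * Real.exp R) := by
  have hinj : Function.Injective (fun n : ℕ => n + j) := add_left_injective j
  rw [← hinj.hasSum_iff]
  · refine ((hasSum_pow_div_factorial R).mul_left (R ^ j / (j.factorial : ℝ))).of_forall_eq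
      (fun n => ?_) rfl
    have h : ((n + j).choose j : ℝ) * n.factorial * j.factorial = (n + j).factorial := by
      have := Nat.add_choose_mul_factorial_mul_factorial n j
      exact_mod_cast this
    have h1 : ((n + j).factorial : ℝ) ≠ 0 := by positivity
    simp only [Function.comp]
    field_simp
    rw [← h, pow_add]
    ring
  · intro m hm
    have : m < j := by
      by_contra h
      exact hm ⟨m - j, by simp; omega⟩
    simp [Nat.choose_eq_zero_of_lt this]

lemma tau_div_factorial (s : ℕ) (x : ℝ) :
    tau s x / (s.factorial : ℝ) = ∑ ij ∈ Finset.HasAntidiagonal.antidiagonal s,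
      Ring.choose x ij.1 * ((-x) ^ ij.2 / (ij.2.factorial : ℝ)) := by
  have : (s.factorial : ℝ) ≠ 0 := by positivity
  rw [tau, mul_div_cancel_left₀ _ this, PowerSeries.coeff_mul]
  refine Finset.sum_congr rfl fun ij _ => ?_
  simp [PowerSeries.coeff_exp, div_eq_mul_inv]

lemma hasSum_poisson_choose (R : ℝ) (s : ℕ) :
    HasSum (fun m : ℕ => Real.exp (-R) * (R ^ m / (m.factorial : ℝ)) *
      Ring.choose ((m : ℝ) - R) s) (tau s (-R) / (s.factorial : ℝ)) := by
  rw [tau_div_factorial, neg_neg]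
  have h : ∀ ij ∈ Finset.HasAntidiagonal.antidiagonal s, HasSum (fun m : ℕ =>
      Ring.choose (-R) ij.1 * Real.exp (-R) * (R ^ m / (m.factorial : ℝ) * (m.choose ij.2 : ℝ)))
      (Ring.choose (-R) ij.1 * (R ^ ij.2 / (ij.2.factorial : ℝ))) := by
    intro ij _
    refine ((hasSum_pow_div_factorial_mul_choose R ij.2).mul_left
      (Ring.choose (-R) ij.1 * Real.exp (-R))).of_forall_eq (fun m => rfl) ?_
    rw [Real.exp_neg]
    field_simp
  refine (hasSum_sum h).of_forall_eq (fun m => ?_) rfl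
  -- Vandermonde's identity reduces the moment to the factorial moments of `m`, matching the Cauchy
  -- product that defines `tau`.
  rw [show (m : ℝ) - R = -R + m by ring, Ring.add_choose_eq s (Commute.all _ _), Finset.mul_sum]
  refine Finset.sum_congr rfl fun ij _ => ?_
  rw [Ring.choose_natCast]
  ring

lemma hasSum_poisson_exp (R u : ℝ) :
    HasSum (fun m : ℕ => Real.exp (-R) * (R ^ m / (m.factorial : ℝ)) *
      Real.exp (u * ((m : ℝ) - R))) (Real.exp (R * (Real.exp u - 1 - u))) := by
  refine ((hasSum_pow_div_factorial (R * Real.exp u)).mul_left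
    (Real.exp (-R) * Real.exp (-(u * R)))).of_forall_eq (fun m => ?_) ?_
  · rw [mul_sub, sub_eq_add_neg, Real.exp_add, mul_pow, ← Real.exp_nat_mul, mul_comm u]
    ring
  · rw [← Real.exp_add, ← Real.exp_add]
    ring_nf

lemma poisson_exp_le {R u : ℝ} (hR : 0 ≤ R) (hu : |u| ≤ 1) :
    Real.exp (R * (Real.exp u - 1 - u)) ≤ Real.exp (R * u ^ 2) := by
  have := (le_abs_self _).trans (Real.abs_exp_sub_one_sub_id_le hu)
  gcongr

/-- Exponential moments of the normalised Poisson distribution. -/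
lemma poisson_exp_abs {R a : ℝ} (hR : 0 < R) (ha : 0 ≤ a) (haR : a ≤ √R) :
    Summable (fun m : ℕ => Real.exp (-R) * (R ^ m / (m.factorial : ℝ)) *
      Real.exp (a * (|(m : ℝ) - R| / √R))) ∧
    ∑' m : ℕ, Real.exp (-R) * (R ^ m / (m.factorial : ℝ)) *
      Real.exp (a * (|(m : ℝ) - R| / √R)) ≤ 2 * Real.exp (a ^ 2) := by
  have hs : 0 < √R := Real.sqrt_pos.2 hR
  have hsq : √R ^ 2 = R := Real.sq_sqrt hR.le
  -- `e^|v| ≤ e^v + e^(-v)` reduces to the moment generating function at `u = ±a/√R`, where `R u² =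
  -- a²`.
  have hle : ∀ m : ℕ, Real.exp (-R) * (R ^ m / (m.factorial : ℝ)) *
      Real.exp (a * (|(m : ℝ) - R| / √R)) ≤
      Real.exp (-R) * (R ^ m / (m.factorial : ℝ)) * Real.exp (a / √R * ((m : ℝ) - R)) +
      Real.exp (-R) * (R ^ m / (m.factorial : ℝ)) * Real.exp (-(a / √R) * ((m : ℝ) - R)) := by
    intro m
    rw [← mul_add]
    gcongr
    rcases abs_cases ((m : ℝ) - R) with ⟨h, -⟩ | ⟨h, -⟩
    · rw [h, show a * (((m : ℝ) - R) / √R) = a / √R * ((m : ℝ) - R) by ring]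
      linarith [Real.exp_pos (-(a / √R) * ((m : ℝ) - R))]
    · rw [h, show a * (-((m : ℝ) - R) / √R) = -(a / √R) * ((m : ℝ) - R) by ring]
      linarith [Real.exp_pos ((a / √R) * ((m : ℝ) - R))]
  have hsum := (hasSum_poisson_exp R (a / √R)).add (hasSum_poisson_exp R (-(a / √R)))
  have hS := Summable.of_nonneg_of_le (fun m => by positivity) hle hsum.summable
  refine ⟨hS, (hS.tsum_le_tsum hle hsum.summable).trans ?_⟩
  rw [hsum.tsum_eq]
  have hu : |a / √R| ≤ 1 := by
    rw [abs_of_nonneg (by positivity), div_le_one hs]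
    exact haR
  have h1 := poisson_exp_le hR.le hu
  have h2 := poisson_exp_le (u := -(a / √R)) hR.le (by rwa [abs_neg])
  have h3 : R * (a / √R) ^ 2 = a ^ 2 := by
    rw [div_pow, hsq]; field_simp
  rw [neg_sq] at h2
  rw [h3] at h1 h2
  linarith

/-! ### Generalised Rolle theorem. -/

/-- Repeated application of Rolle's theorem. -/
lemma exists_iteratedDeriv_eq_zero_of_zeros {U : Set ℝ} (hU : IsOpen U) (n : ℕ) :
    ∀ (f : ℝ → ℝ) (x : ℕ → ℝ), ContDiffOn ℝ n f U → Icc (x 0) (x n) ⊆ U →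
      (∀ i < n, x i < x (i + 1)) → (∀ i ≤ n, f (x i) = 0) →
      ∃ ξ ∈ Icc (x 0) (x n), iteratedDeriv n f ξ = 0 := by
  induction n with
  | zero =>
    intro f x _ _ _ h0
    exact ⟨x 0, by simp, by simpa using h0 0 le_rfl⟩
  | succ n ih =>
    intro f x hf hsub hlt h0
    have hmono : ∀ j, j ≤ n + 1 → ∀ i ≤ j, x i ≤ x j := by
      intro j
      induction j with
      | zero => intro _ i hi; rw [Nat.le_zero.1 hi]
      | succ j ihj =>
        intro hj i hi
        rcases Nat.le_succ_iff.1 hi with h | h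
        · exact (ihj (by omega) i h).trans (hlt j (by omega)).le
        · rw [h]
    have hcont : ContinuousOn f U := hf.continuousOn
    have hy : ∀ i, ∃ y, i ≤ n → y ∈ Ioo (x i) (x (i + 1)) ∧ deriv f y = 0 := by
      intro i
      by_cases hi : i ≤ n
      · have hs : Icc (x i) (x (i + 1)) ⊆ U :=
          (Icc_subset_Icc (hmono i (by omega) 0 (by omega))
            (hmono (n + 1) le_rfl (i + 1) (by omega))).trans hsub
        obtain ⟨y, hy, hy'⟩ := exists_deriv_eq_zero (hlt i (by omega)) (hcont.mono hs)
          ((h0 i (by omega)).trans (h0 (i + 1) (by omega)).symm)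
        exact ⟨y, fun _ => ⟨hy, hy'⟩⟩
      · exact ⟨0, fun h => absurd h hi⟩
    choose y hy using hy
    have hI : Icc (y 0) (y n) ⊆ Icc (x 0) (x (n + 1)) :=
      Icc_subset_Icc (hy 0 (by omega)).1.1.le (hy n le_rfl).1.2.le
    obtain ⟨ξ, hξ, h⟩ := ih (deriv f) y
      (hf.deriv_of_isOpen hU (by norm_cast)) (hI.trans hsub)
      (fun i hi => (hy i (by omega)).1.2.trans (hy (i + 1) (by omega)).1.1)
      (fun i hi => (hy i hi).2)
    exact ⟨ξ, hI hξ, by rw [iteratedDeriv_succ']; exact h⟩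

lemma exists_iteratedDeriv_eq_zero_of_finset {U : Set ℝ} (hU : IsOpen U) {n : ℕ} {f : ℝ → ℝ}
    (hf : ContDiffOn ℝ n f U) {a b : ℝ} (hab : Icc a b ⊆ U) {S : Finset ℝ} (hS : S.card = n + 1)
    (hSI : ∀ x ∈ S, x ∈ Icc a b) (h0 : ∀ x ∈ S, f x = 0) :
    ∃ ξ ∈ Icc a b, iteratedDeriv n f ξ = 0 := by
  let e := S.orderEmbOfFin hS
  let x : ℕ → ℝ := fun i => if h : i < n + 1 then e ⟨i, h⟩ else 0
  have hx : ∀ i (h : i < n + 1), x i = e ⟨i, h⟩ := fun i h => dif_pos h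
  have hmem : ∀ i, i < n + 1 → x i ∈ S := fun i h => by
    rw [hx i h]; exact S.orderEmbOfFin_mem hS _
  have hI : Icc (x 0) (x n) ⊆ Icc a b :=
    Icc_subset_Icc (hSI _ (hmem 0 (by omega))).1 (hSI _ (hmem n (by omega))).2
  obtain ⟨ξ, hξ, h⟩ := exists_iteratedDeriv_eq_zero_of_zeros hU n f x hf (hI.trans hab)
    (fun i hi => by
      rw [hx i (by omega), hx (i + 1) (by omega)]
      exact e.strictMono (by simp))
    (fun i hi => h0 _ (hmem i (by omega)))
  exact ⟨ξ, hI hξ, h⟩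

/-! ### Newton interpolation and its error term. -/

/-- The polynomial `x ↦ Ring.choose (x - a) s`. -/
noncomputable def choosePoly (a : ℝ) (s : ℕ) : Polynomial ℝ :=
  Polynomial.C ((s.factorial : ℝ)⁻¹) * (descPochhammer ℝ s).comp (Polynomial.X - Polynomial.C a)

lemma ring_choose_eq_prod (x : ℝ) (s : ℕ) :
    Ring.choose x s = (s.factorial : ℝ)⁻¹ * ∏ i ∈ Finset.range s, (x - i) := by
  rw [Ring.choose_eq_smul, smul_eq_mul, ← descPochhammer_eval_eq_prod_range,
    Polynomial.eval_eq_smeval, ← descPochhammer_map (Int.castRingHom ℝ), ← Polynomial.eval_eq_smeval,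
    Polynomial.eval_map, ← Polynomial.eval₂_smulOneHom_eq_smeval]
  rw [Subsingleton.elim (Int.castRingHom ℝ) RingHom.smulOneHom]

lemma eval_choosePoly (a : ℝ) (s : ℕ) (x : ℝ) :
    (choosePoly a s).eval x = Ring.choose (x - a) s := by
  simp [choosePoly, ring_choose_eq_prod, descPochhammer_eval_eq_prod_range]

lemma natDegree_choosePoly_le (a : ℝ) (s : ℕ) : (choosePoly a s).natDegree ≤ s := by
  refine (Polynomial.natDegree_C_mul_le _ _).trans ?_
  rw [Polynomial.natDegree_comp, descPochhammer_natDegree, Polynomial.natDegree_X_sub_C, mul_one]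

lemma coeff_choosePoly (a : ℝ) (s : ℕ) : (choosePoly a s).coeff s = (s.factorial : ℝ)⁻¹ := by
  have h : ((descPochhammer ℝ s).comp (Polynomial.X - Polynomial.C a)).Monic :=
    (monic_descPochhammer ℝ s).comp_X_sub_C a
  have h2 := h.coeff_natDegree
  rw [Polynomial.natDegree_comp, descPochhammer_natDegree, Polynomial.natDegree_X_sub_C,
    mul_one] at h2
  rw [choosePoly, Polynomial.coeff_C_mul, h2, mul_one]

lemma contDiff_polynomial_eval (p : Polynomial ℝ) (n : WithTop ℕ∞) :
    ContDiff ℝ n fun x => p.eval x := by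
  simpa using p.contDiff_aeval (𝕜 := ℝ) n

lemma iteratedDeriv_polynomial_eval (p : Polynomial ℝ) (n : ℕ) :
    iteratedDeriv n (fun x => p.eval x) = fun x => (Polynomial.derivative^[n] p).eval x := by
  induction n with
  | zero => simp
  | succ n ih =>
    rw [iteratedDeriv_succ, ih, Function.iterate_succ_apply']
    ext x
    simp

lemma iteratedDeriv_polynomial_eval_of_natDegree_le {p : Polynomial ℝ} {n : ℕ}
    (hp : p.natDegree ≤ n) (x : ℝ) :
    iteratedDeriv n (fun x => p.eval x) x = n.factorial * p.coeff n := by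
  rw [iteratedDeriv_polynomial_eval]
  have h : (Polynomial.derivative^[n] p).natDegree = 0 := by
    have := Polynomial.natDegree_iterate_derivative p n
    omega
  rw [Polynomial.eq_C_of_natDegree_eq_zero h]
  simp [Polynomial.coeff_iterate_derivative, Nat.descFactorial_self]

/-- Newton's interpolation polynomial of degree `N` with nodes `a, a + 1, …, a + N`. -/
noncomputable def newtonPoly (f : ℝ → ℝ) (N : ℕ) (a : ℝ) : Polynomial ℝ :=
  ∑ s ∈ Finset.range (N + 1), Polynomial.C ((fwdDiff (1 : ℝ))^[s] f a) * choosePoly a s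

lemma eval_newtonPoly (f : ℝ → ℝ) (N : ℕ) (a x : ℝ) :
    (newtonPoly f N a).eval x =
      ∑ s ∈ Finset.range (N + 1), (fwdDiff (1 : ℝ))^[s] f a * Ring.choose (x - a) s := by
  simp [newtonPoly, Polynomial.eval_finsetSum, eval_choosePoly]

lemma natDegree_newtonPoly_le (f : ℝ → ℝ) (N : ℕ) (a : ℝ) : (newtonPoly f N a).natDegree ≤ N := by
  refine Polynomial.natDegree_sum_le_of_forall_le _ _ fun s hs => ?_
  refine (Polynomial.natDegree_C_mul_le _ _).trans ((natDegree_choosePoly_le a s).trans ?_)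
  have := Finset.mem_range.1 hs
  omega

lemma eval_newtonPoly_node (f : ℝ → ℝ) (N : ℕ) (a : ℝ) {k : ℕ} (hk : k ≤ N) :
    (newtonPoly f N a).eval (a + k) = f (a + k) := by
  have h := shift_eq_sum_fwdDiff_iter (1 : ℝ) f k a
  rw [nsmul_eq_mul, mul_one] at h
  rw [eval_newtonPoly, h]
  symm
  refine (Finset.sum_subset (Finset.range_mono (by omega)) fun s _ hs => ?_).trans
    (Finset.sum_congr rfl fun s _ => ?_)
  · rw [Nat.choose_eq_zero_of_lt (by simpa using hs), zero_smul]
  · rw [add_sub_cancel_left, Ring.choose_natCast, nsmul_eq_mul, mul_comm]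

/-- The error term of Newton's interpolation formula. -/
lemma exists_newton_error {U : Set ℝ} (hU : IsOpen U) {f : ℝ → ℝ} {N : ℕ}
    (hf : ContDiffOn ℝ ((N + 1 : ℕ) : WithTop ℕ∞) f U) (a x : ℝ)
    (hI : Icc (min x a) (max x (a + N)) ⊆ U) :
    ∃ ξ ∈ Icc (min x a) (max x (a + N)),
      f x - (newtonPoly f N a).eval x =
        Ring.choose (x - a) (N + 1) * iteratedDeriv (N + 1) f ξ := by
  let S : Finset ℝ := (Finset.range (N + 1)).image fun k : ℕ => a + (k : ℝ)
  by_cases hx : x ∈ S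
  · obtain ⟨k, hk, rfl⟩ := Finset.mem_image.1 hx
    have hk' : k < N + 1 := Finset.mem_range.1 hk
    -- At a node both sides vanish, so any `ξ` serves.
    refine ⟨a + k, ⟨min_le_left _ _, le_max_left _ _⟩, ?_⟩
    rw [eval_newtonPoly_node f N a (by omega), add_sub_cancel_left, Ring.choose_natCast,
      Nat.choose_eq_zero_of_lt hk']
    simp
  · set w := Ring.choose (x - a) (N + 1) with hw
    have hw0 : w ≠ 0 := by
      rw [hw, ring_choose_eq_prod]
      refine mul_ne_zero (by positivity) (Finset.prod_ne_zero_iff.2 fun i hi h => hx ?_)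
      exact Finset.mem_image.2 ⟨i, hi, by linarith⟩
    -- This `c` makes `f - q` vanish at `x` as well as at the `N + 1` nodes, while the derivative of
    -- `q` of order `N + 1` is constantly `c`.
    set c := (f x - (newtonPoly f N a).eval x) / w with hc
    let q := newtonPoly f N a + Polynomial.C c * choosePoly a (N + 1)
    have hq : ∀ t, q.eval t = (newtonPoly f N a).eval t + c * Ring.choose (t - a) (N + 1) := by
      intro t; simp [q, eval_choosePoly]
    have hqd : q.natDegree ≤ N + 1 := by
      refine Polynomial.natDegree_add_le_of_degree_le
        ((natDegree_newtonPoly_le f N a).trans (by omega))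
        ((Polynomial.natDegree_C_mul_le _ _).trans (natDegree_choosePoly_le a _))
    have hqc : ((N + 1).factorial : ℝ) * q.coeff (N + 1) = c := by
      have h0 : (newtonPoly f N a).coeff (N + 1) = 0 :=
        Polynomial.coeff_eq_zero_of_natDegree_lt
          (lt_of_le_of_lt (natDegree_newtonPoly_le f N a) (by omega))
      have : ((N + 1).factorial : ℝ) ≠ 0 := by positivity
      rw [Polynomial.coeff_add, h0, Polynomial.coeff_C_mul, coeff_choosePoly]
      field_simp
      ring
    have hqs : ContDiff ℝ ((N + 1 : ℕ) : WithTop ℕ∞) fun t => q.eval t :=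
      contDiff_polynomial_eval q _
    have hg : ContDiffOn ℝ ((N + 1 : ℕ) : WithTop ℕ∞) (f - fun t => q.eval t) U :=
      hf.sub hqs.contDiffOn
    have hcard : (insert x S).card = N + 1 + 1 := by
      rw [Finset.card_insert_of_notMem hx, Finset.card_image_of_injective, Finset.card_range]
      intro i j hij
      simpa using hij
    obtain ⟨ξ, hξ, h⟩ := exists_iteratedDeriv_eq_zero_of_finset hU hg hI hcard
      (by
        intro t ht
        rcases Finset.mem_insert.1 ht with rfl | ht
        · exact ⟨min_le_left _ _, le_max_left _ _⟩
        · obtain ⟨k, hk, rfl⟩ := Finset.mem_image.1 ht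
          have hk' : (k : ℝ) ≤ N := by
            have := Finset.mem_range.1 hk
            exact_mod_cast Nat.lt_succ_iff.1 this
          have := (Nat.cast_nonneg k : (0 : ℝ) ≤ k)
          exact ⟨(min_le_right _ _).trans (by linarith), le_max_of_le_right (by linarith)⟩)
      (by
        intro t ht
        rw [Pi.sub_apply, hq]
        rcases Finset.mem_insert.1 ht with rfl | ht
        · rw [← hw, hc, div_mul_cancel₀ _ hw0]; ring
        · obtain ⟨k, hk, rfl⟩ := Finset.mem_image.1 ht
          have hk' := Finset.mem_range.1 hk
          rw [eval_newtonPoly_node f N a (by omega), add_sub_cancel_left, Ring.choose_natCast,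
            Nat.choose_eq_zero_of_lt hk']
          simp)
    refine ⟨ξ, hξ, ?_⟩
    have hfξ : ContDiffAt ℝ ((N + 1 : ℕ) : WithTop ℕ∞) f ξ := hf.contDiffAt (hU.mem_nhds (hI hξ))
    rw [iteratedDeriv_sub hfξ hqs.contDiffAt,
      iteratedDeriv_polynomial_eval_of_natDegree_le hqd, hqc] at h
    rw [sub_eq_zero.1 h, hc, mul_div_cancel₀ _ hw0]

/-- The error term contains a derivative of order `N + 1`, which is zero here. This allows
interpolants with different base points to be compared. -/
lemma eval_newtonPoly_polynomial {p : Polynomial ℝ} {N : ℕ} (hp : p.natDegree ≤ N) (a x : ℝ) :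
    (newtonPoly (fun t => p.eval t) N a).eval x = p.eval x := by
  obtain ⟨ξ, -, h⟩ := exists_newton_error (N := N) isOpen_univ
    ((contDiff_polynomial_eval p _).contDiffOn : ContDiffOn ℝ _ (fun t => p.eval t) univ) a x (subset_univ _)
  rw [iteratedDeriv_polynomial_eval_of_natDegree_le (by omega),
    Polynomial.coeff_eq_zero_of_natDegree_lt (by omega)] at h
  simp only [mul_zero] at h
  linarith

lemma eval_newtonPoly_sub (f g : ℝ → ℝ) (N : ℕ) (a x : ℝ) :
    (newtonPoly (f - g) N a).eval x =
      (newtonPoly f N a).eval x - (newtonPoly g N a).eval x := by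
  simp only [eval_newtonPoly, ← Finset.sum_sub_distrib, ← sub_mul]
  refine Finset.sum_congr rfl fun s _ => ?_
  congr 1
  simp only [fwdDiff_iter_eq_sum_shift, ← Finset.sum_sub_distrib, Pi.sub_apply, smul_sub]

/-! ### Bounds for the interpolation error. -/

lemma abs_fwdDiff_iter_le {f : ℝ → ℝ} {a M : ℝ} {s : ℕ} (h : ∀ k ≤ s, |f (a + k)| ≤ M) :
    |(fwdDiff (1 : ℝ))^[s] f a| ≤ 2 ^ s * M := by
  rw [fwdDiff_iter_eq_sum_shift]
  refine (Finset.abs_sum_le_sum_abs _ _).trans ?_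
  have : (2 : ℝ) ^ s * M = ∑ k ∈ Finset.range (s + 1), (s.choose k : ℝ) * M := by
    rw [← Finset.sum_mul]
    congr 1
    exact_mod_cast (Nat.sum_range_choose s).symm
  rw [this]
  refine Finset.sum_le_sum fun k hk => ?_
  have hk' := Finset.mem_range.1 hk
  rw [nsmul_eq_mul, mul_one, zsmul_eq_mul, abs_mul]
  refine mul_le_mul (le_of_eq ?_) (h k (by omega)) (abs_nonneg _) (by positivity)
  simp [abs_mul]

/-- Uses `v^s/s! ≤ e^v` at `v = (|x| + s)/ρ`. The scale `ρ = √R` is the Poisson standard deviation.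
-/
lemma abs_choose_le (x : ℝ) (s : ℕ) {ρ : ℝ} (hρ : 0 < ρ) :
    |Ring.choose x s| ≤ ρ ^ s * Real.exp ((|x| + s) / ρ) := by
  have h1 : |Ring.choose x s| ≤ (|x| + s) ^ s / s.factorial := by
    rw [ring_choose_eq_prod, abs_mul, abs_of_nonneg (by positivity), Finset.abs_prod, mul_comm,
      div_eq_mul_inv]
    gcongr
    calc ∏ i ∈ Finset.range s, |x - i| ≤ ∏ _i ∈ Finset.range s, (|x| + s) := by
          refine Finset.prod_le_prod (fun _ _ => abs_nonneg _) fun i hi => ?_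
          have : (i : ℝ) ≤ s := by exact_mod_cast (Finset.mem_range.1 hi).le
          refine (abs_sub _ _).trans ?_
          rw [Nat.abs_cast]
          linarith
      _ = (|x| + s) ^ s := by simp
  refine h1.trans ?_
  have h2 := Real.pow_div_factorial_le_exp ((|x| + s) / ρ) (by positivity) s
  calc (|x| + s) ^ s / s.factorial = ρ ^ s * (((|x| + s) / ρ) ^ s / s.factorial) := by
        rw [div_pow]; field_simp
    _ ≤ _ := by gcongr

/-- Newton's error term under a pointwise bound of the top derivative by a slowly varying `G`. -/
lemma newton_error_le {N : ℕ} {B C T : ℝ} (hB : 0 < B) (hC : 0 < C) (hT : 0 < T) {φ G : ℝ → ℝ}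
    (hφ : ContDiffOn ℝ ((N + 1 : ℕ) : WithTop ℕ∞) φ (Ioi 0))
    (hG : ∀ x : ℝ, T ≤ x → 0 < G x)
    (hd : ∀ x : ℝ, T ≤ x → |iteratedDeriv (N + 1) φ x| ≤ G x / x ^ (N + 1))
    (hGG : ∀ x y : ℝ, T ≤ x → T ≤ y → G y ≤ B * G x * Real.exp (C * (|y - x| / √x)))
    {a x R E L : ℝ} (ha : T ≤ a) (hx : T ≤ x) (hR : T ≤ R) (hL : 0 < L)
    (hE : ∀ ξ ∈ Icc (min x a) (max x (a + N)), |ξ - R| ≤ E ∧ L ≤ ξ) :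
    |φ x - (newtonPoly φ N a).eval x| ≤ |Ring.choose (x - a) (N + 1)| *
      (B * G R * Real.exp (C * (E / √R)) / L ^ (N + 1)) := by
  have hmin : T ≤ min x a := le_min hx ha
  obtain ⟨ξ, hξ, h⟩ := exists_newton_error isOpen_Ioi hφ a x
    (fun t ht => hT.trans_le (hmin.trans ht.1))
  have hTξ : T ≤ ξ := hmin.trans hξ.1
  have hGR := hG R hR
  rw [h, abs_mul]
  gcongr
  refine (hd ξ hTξ).trans (div_le_div₀ (by positivity) ?_ (by positivity)
    (pow_le_pow_left₀ hL.le (hE ξ hξ).2 _))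
  refine (hGG R ξ hR hTξ).trans ?_
  have := (hE ξ hξ).1
  gcongr

lemma newton_error_near_le {N : ℕ} {B C T : ℝ} (hB : 0 < B) (hC : 0 < C) (hT : 0 < T)
    {φ G : ℝ → ℝ}
    (hφ : ContDiffOn ℝ ((N + 1 : ℕ) : WithTop ℕ∞) φ (Ioi 0))
    (hG : ∀ x : ℝ, T ≤ x → 0 < G x)
    (hd : ∀ x : ℝ, T ≤ x → |iteratedDeriv (N + 1) φ x| ≤ G x / x ^ (N + 1))
    (hGG : ∀ x y : ℝ, T ≤ x → T ≤ y → G y ≤ B * G x * Real.exp (C * (|y - x| / √x)))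
    {x R : ℝ} (hx : T ≤ x) (hR : T ≤ R) (hR1 : 1 ≤ R)
    (hRT : (R / T) ^ (N + 1) ≤ Real.exp (√R / 2)) :
    |φ x - (newtonPoly φ N R).eval x| ≤
      B * 2 ^ (N + 1) * Real.exp (N + 1 + C * N) * ((√R ^ (N + 1))⁻¹ * G R) *
        Real.exp ((2 + C) * (|x - R| / √R)) := by
  have hs : 1 ≤ √R := Real.one_le_sqrt.2 hR1
  have hs0 : 0 < √R := by linarith
  have hsq : √R ^ 2 = R := Real.sq_sqrt (by linarith)
  have hR0 : 0 < R := by linarith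
  have hGR := hG R hR
  have hmin : T ≤ min x R := le_min hx hR
  have hN : (0 : ℝ) ≤ N := N.cast_nonneg
  have hmin0 : 0 < min x R := hT.trans_le hmin
  set t := |x - R| / √R with ht
  have h1 := newton_error_le hB hC hT hφ hG hd hGG hR hx hR hmin0
    (E := |x - R| + N) (fun ξ hξ => ⟨by
      have := neg_abs_le (x - R)
      have := le_abs_self (x - R)
      have := abs_nonneg (x - R)
      refine abs_le.2 ⟨?_, ?_⟩
      · rcases le_total x R with h | h
        · have := hξ.1; rw [min_eq_left h] at this; linarith
        · have := hξ.1; rw [min_eq_right h] at this; linarith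
      · have := hξ.2
        rcases le_max_iff.1 this with h | h <;> linarith, hξ.1⟩)
  have hadd : ∀ c : ℝ, 0 ≤ c → (|x - R| + c) / √R ≤ t + c := by
    intro c hc
    rw [add_div]
    have := div_le_self hc hs
    linarith
  have h2 : |Ring.choose (x - R) (N + 1)| ≤ √R ^ (N + 1) * Real.exp (t + (N + 1)) := by
    refine (abs_choose_le (x - R) (N + 1) hs0).trans ?_
    push_cast
    have := hadd (N + 1) (by positivity)
    gcongr
  have h3 : Real.exp (C * ((|x - R| + N) / √R)) ≤ Real.exp (C * (t + N)) := by
    have := hadd N hN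
    gcongr
  have h4 : R ^ (N + 1) / min x R ^ (N + 1) ≤ 2 ^ (N + 1) * Real.exp t := by
    rw [← div_pow]
    have ht0 : 0 ≤ t := by positivity
    by_cases hxR : R / 2 ≤ x
    · have : R / min x R ≤ 2 := by
        rw [div_le_iff₀ hmin0]
        have : R / 2 ≤ min x R := le_min hxR (by linarith)
        linarith
      calc (R / min x R) ^ (N + 1) ≤ 2 ^ (N + 1) := by gcongr
        _ ≤ _ := le_mul_of_one_le_right (by positivity) (Real.one_le_exp ht0)
    -- Left of `R / 2` only `min x R ≥ T` is known; the loss `(R / T) ^ (N + 1)` is absorbed because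
    -- `t` is at least `√R / 2`.
    · have h5 : √R / 2 ≤ t := by
        rw [ht, le_div_iff₀ hs0]
        have := neg_abs_le (x - R)
        nlinarith
      calc (R / min x R) ^ (N + 1) ≤ (R / T) ^ (N + 1) := by gcongr
        _ ≤ Real.exp (√R / 2) := hRT
        _ ≤ Real.exp t := by gcongr
        _ ≤ _ := le_mul_of_one_le_left (by positivity) (one_le_pow₀ (by norm_num))
  have h5 : ((min x R) ^ (N + 1))⁻¹ ≤ 2 ^ (N + 1) * Real.exp t * (R ^ (N + 1))⁻¹ := by
    rw [le_mul_inv_iff₀ (by positivity), mul_comm, ← div_eq_mul_inv]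
    exact h4
  refine h1.trans ?_
  calc |Ring.choose (x - R) (N + 1)| *
        (B * G R * Real.exp (C * ((|x - R| + N) / √R)) / min x R ^ (N + 1))
      ≤ (√R ^ (N + 1) * Real.exp (t + (N + 1))) *
        (B * G R * Real.exp (C * (t + N)) * (2 ^ (N + 1) * Real.exp t * (R ^ (N + 1))⁻¹)) := by
        rw [div_eq_mul_inv]
        gcongr
    _ = _ := by
        rw [show (2 + C) * t = t + t + C * t by ring, show C * (t + N) = C * t + C * N by ring]
        simp only [Real.exp_add]
        have : R ^ (N + 1) = √R ^ (N + 1) * √R ^ (N + 1) := by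
          rw [← mul_pow, ← sq, hsq]
        rw [this]
        field_simp

/-- At points left of the range where the derivative is controlled, the interpolation error is
bounded up to a constant depending on `φ`. -/
lemma newton_error_left_le {N : ℕ} {B C T : ℝ} (hB : 0 < B) (hC : 0 < C) (hT : 0 < T)
    {φ G : ℝ → ℝ}
    (hφ : ContDiffOn ℝ ((N + 1 : ℕ) : WithTop ℕ∞) φ (Ioi 0))
    (hG : ∀ x : ℝ, T ≤ x → 0 < G x)
    (hd : ∀ x : ℝ, T ≤ x → |iteratedDeriv (N + 1) φ x| ≤ G x / x ^ (N + 1))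
    (hGG : ∀ x y : ℝ, T ≤ x → T ≤ y → G y ≤ B * G x * Real.exp (C * (|y - x| / √x))) :
    ∃ A : ℝ, 0 < A ∧ ∀ R : ℝ, T ≤ R → 1 ≤ R → ∀ x : ℝ, 0 ≤ x → x ≤ R →
      |φ x - (newtonPoly φ N R).eval x| ≤ |φ x - (newtonPoly φ N T).eval x| +
        A * (R ^ (2 * N + 1) * Real.exp ((2 + C) * √R) * G R) := by
  have hN : (0 : ℝ) ≤ N := N.cast_nonneg
  refine ⟨(N + 1) * (2 ^ N * (Real.exp (2 * N + 1) * (B * Real.exp (C * N) / T ^ (N + 1))) *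
    Real.exp N), by positivity, fun R hTR hR1 x hx0 hxR => ?_⟩
  have hs : 1 ≤ √R := Real.one_le_sqrt.2 hR1
  have hs0 : 0 < √R := by linarith
  have hsq : √R * √R = R := Real.mul_self_sqrt (by linarith)
  have hsR : √R ≤ R := by nlinarith
  have hGR := hG R hTR
  have hdiv : ∀ c : ℝ, 0 ≤ c → (R + c) / √R ≤ √R + c := by
    intro c hc
    rw [add_div, Real.div_sqrt]
    have := div_le_self hc hs
    linarith
  set Q := newtonPoly φ N T with hQ
  set M := R ^ (N + 1) * Real.exp (√R + (2 * N + 1)) *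
    (B * G R * Real.exp (C * (√R + N)) / T ^ (N + 1)) with hM
  -- Interpolation based at `R` is linear and reproduces `Q`, so it sends `φ - Q` to the interpolant
  -- of `φ` minus `Q`. It therefore suffices to bound `φ - Q` at the nodes `R + k`, which lie in the
  -- controlled range.
  have hr : ∀ k ≤ N, |(φ - fun t => Q.eval t) (R + (k : ℕ))| ≤ M := by
    intro k hk
    have hk' : (k : ℝ) ≤ N := by exact_mod_cast hk
    have hk0 : (0 : ℝ) ≤ k := k.cast_nonneg
    refine (newton_error_le hB hC hT hφ hG hd hGG (le_refl T) (x := R + k) (R := R)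
      (E := R + N) (L := T) (by linarith) hTR hT (fun ξ hξ => ?_)).trans ?_
    · have h1 : T ≤ ξ := (le_min (by linarith) le_rfl).trans hξ.1
      have h2 : ξ ≤ R + N := hξ.2.trans (max_le (by linarith) (by linarith))
      exact ⟨abs_le.2 ⟨by linarith, by linarith⟩, h1⟩
    · have h1 : |Ring.choose (R + k - T) (N + 1)| ≤
          R ^ (N + 1) * Real.exp (√R + (2 * N + 1)) := by
        refine (abs_choose_le _ (N + 1) hs0).trans ?_
        have h2 : (|R + k - T| + ((N + 1 : ℕ) : ℝ)) / √R ≤ √R + (2 * N + 1) := by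
          refine le_trans ?_ (hdiv (2 * N + 1) (by positivity))
          refine div_le_div_of_nonneg_right ?_ hs0.le
          rw [abs_of_nonneg (by linarith)]
          push_cast
          linarith
        gcongr
      have h3 := hdiv N hN
      rw [hM]
      gcongr
  have hP : |(newtonPoly (φ - fun t => Q.eval t) N R).eval x| ≤
      (N + 1) * (2 ^ N * M * (R ^ N * Real.exp (√R + N))) := by
    rw [eval_newtonPoly]
    refine (Finset.abs_sum_le_sum_abs _ _).trans ?_
    calc _ ≤ ∑ _s ∈ Finset.range (N + 1), 2 ^ N * M * (R ^ N * Real.exp (√R + N)) := by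
          refine Finset.sum_le_sum fun s hs' => ?_
          have hsN : s ≤ N := Nat.lt_succ_iff.1 (Finset.mem_range.1 hs')
          have hsN' : (s : ℝ) ≤ N := by exact_mod_cast hsN
          have hs0' : (0 : ℝ) ≤ s := s.cast_nonneg
          rw [abs_mul]
          have hM0 : 0 ≤ M := by positivity
          have h1 : |Ring.choose (x - R) s| ≤ R ^ N * Real.exp (√R + N) := by
            refine (abs_choose_le _ s hs0).trans ?_
            have h2 : (|x - R| + s) / √R ≤ √R + N := by
              refine le_trans ?_ (hdiv N hN)
              gcongr
              rw [abs_of_nonpos (by linarith)]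
              linarith
            have h3 : √R ^ s ≤ R ^ N :=
              (pow_le_pow_left₀ hs0.le hsR s).trans (pow_le_pow_right₀ hR1 hsN)
            gcongr
          have h2 : |(fwdDiff (1 : ℝ))^[s] (φ - fun t => Q.eval t) R| ≤ 2 ^ N * M :=
            (abs_fwdDiff_iter_le fun k hk => hr k (hk.trans hsN)).trans (by
              gcongr
              norm_num)
          gcongr
      _ = _ := by simp
  rw [eval_newtonPoly_sub, eval_newtonPoly_polynomial (natDegree_newtonPoly_le φ N T)] at hP
  have htri : |φ x - (newtonPoly φ N R).eval x| ≤ |φ x - Q.eval x| +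
      |(newtonPoly φ N R).eval x - Q.eval x| := by
    rw [← abs_neg ((newtonPoly φ N R).eval x - Q.eval x)]
    refine le_trans (le_of_eq ?_) (abs_add_le _ _)
    congr 1
    ring
  refine htri.trans ?_
  gcongr
  refine hP.trans (le_of_eq ?_)
  rw [hM, show (2 + C) * √R = √R + √R + C * √R by ring, mul_add C]
  simp only [Real.exp_add, pow_add, two_mul]
  field_simp

/-- Under the hypotheses of the theorem, `φ` grows at most exponentially. -/
lemma exists_exp_bound {N : ℕ} {B C T : ℝ} (hB : 0 < B) (hC : 0 < C) (hT : 0 < T)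
    {φ G : ℝ → ℝ}
    (hφ : ContDiffOn ℝ ((N + 1 : ℕ) : WithTop ℕ∞) φ (Ioi 0))
    (hG : ∀ x : ℝ, T ≤ x → 0 < G x)
    (hd : ∀ x : ℝ, T ≤ x → |iteratedDeriv (N + 1) φ x| ≤ G x / x ^ (N + 1))
    (hGG : ∀ x y : ℝ, T ≤ x → T ≤ y → G y ≤ B * G x * Real.exp (C * (|y - x| / √x))) :
    ∃ A D : ℝ, ∀ x : ℝ, T ≤ x → |φ x| ≤ A * Real.exp (D * x) := by
  have hN : (0 : ℝ) ≤ N := N.cast_nonneg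
  have hGT := hG T le_rfl
  have hsT : 0 < √T := Real.sqrt_pos.2 hT
  have hch : ∀ x : ℝ, T ≤ x → ∀ s : ℕ,
      |Ring.choose (x - T) s| ≤ Real.exp (x + s) := by
    intro x hx s
    refine (abs_choose_le _ s one_pos).trans ?_
    rw [one_pow, one_mul, div_one, abs_of_nonneg (by linarith)]
    gcongr
    linarith
  refine ⟨Real.exp ((N + 1 : ℕ) : ℝ) * (B * G T * Real.exp (C * (N / √T)) / T ^ (N + 1)) +
    ∑ s ∈ Finset.range (N + 1), |(fwdDiff (1 : ℝ))^[s] φ T| * Real.exp s, 1 + C / √T,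
    fun x hx => ?_⟩
  have hx0 : 0 < x := hT.trans_le hx
  have h1 : |φ x - (newtonPoly φ N T).eval x| ≤ Real.exp (x + (N + 1 : ℕ)) *
      (B * G T * Real.exp (C * ((x + N) / √T)) / T ^ (N + 1)) := by
    refine (newton_error_le hB hC hT hφ hG hd hGG (le_refl T) (x := x) (R := T)
      (E := x + N) (L := T) hx le_rfl hT (fun ξ hξ => ?_)).trans ?_
    · have h1 : T ≤ ξ := (le_min hx le_rfl).trans hξ.1
      have h2 : ξ ≤ x + N := hξ.2.trans (max_le (by linarith) (by linarith))
      exact ⟨abs_le.2 ⟨by linarith, by linarith⟩, h1⟩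
    · have := hch x hx (N + 1)
      gcongr
  have h2 : |(newtonPoly φ N T).eval x| ≤
      ∑ s ∈ Finset.range (N + 1), |(fwdDiff (1 : ℝ))^[s] φ T| * Real.exp (x + s) := by
    rw [eval_newtonPoly]
    refine (Finset.abs_sum_le_sum_abs _ _).trans (Finset.sum_le_sum fun s _ => ?_)
    rw [abs_mul]
    have := hch x hx s
    gcongr
  have h3 : |φ x| ≤ |φ x - (newtonPoly φ N T).eval x| + |(newtonPoly φ N T).eval x| := by
    refine le_trans (le_of_eq ?_) (abs_add_le _ _)
    rw [sub_add_cancel]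
  refine h3.trans ((add_le_add h1 h2).trans ?_)
  rw [add_mul, Finset.sum_mul]
  refine add_le_add (le_of_eq ?_) (Finset.sum_le_sum fun s _ => ?_)
  · rw [show C * ((x + N) / √T) = C / √T * x + C * (N / √T) by ring, one_add_mul]
    simp only [Real.exp_add]
    ring
  · rw [add_comm x, Real.exp_add, mul_assoc]
    gcongr
    have : 0 ≤ C / √T * x := by positivity
    linarith

/-! ### Summation against the Poisson weights and conclusion. -/

lemma eventually_rpow_mul_exp_le_one (c p D : ℝ) (hc : 0 ≤ c) :
    ∀ᶠ R : ℝ in atTop, c * (R ^ p * Real.exp (D * √R) * Real.exp (-R)) ≤ 1 := by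
  have h := (tendsto_rpow_mul_exp_neg_mul_atTop_nhds_zero p (1 / 2) (by norm_num)).const_mul c
  rw [mul_zero] at h
  -- Beyond `(2 * D) ^ 2` one has `D √R ≤ R / 2`, leaving decay `e^(-R/2)`.
  filter_upwards [h.eventually_le_const one_pos, eventually_ge_atTop ((2 * D) ^ 2),
    eventually_gt_atTop 0] with R h1 h2 h3
  refine le_trans ?_ h1
  rw [mul_assoc, ← Real.exp_add]
  have h4 : 2 * D ≤ √R := Real.le_sqrt_of_sq_le h2
  have h5 : √R * √R = R := Real.mul_self_sqrt h3.le
  have h6 : D * √R + -R ≤ -(1 / 2) * R := by nlinarith [Real.sqrt_nonneg R]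
  gcongr

lemma summable_of_exp_bound {φ : ℝ → ℝ} {A D T : ℝ}
    (h : ∀ x : ℝ, T ≤ x → |φ x| ≤ A * Real.exp (D * x)) (R : ℝ) :
    Summable fun m : ℕ => φ (m : ℝ) / (m.factorial : ℝ) * R ^ m := by
  have hs := (hasSum_pow_div_factorial (Real.exp D * |R|)).summable.mul_left A
  refine hs.of_norm_bounded_eventually_nat ?_
  filter_upwards [eventually_ge_atTop ⌈T⌉₊] with m hm
  have hm' : T ≤ m := Nat.ceil_le.1 hm
  rw [Real.norm_eq_abs, abs_mul, abs_div, Nat.abs_cast, abs_pow, mul_pow, ← Real.exp_nat_mul]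
  have := h m hm'
  calc |φ m| / m.factorial * |R| ^ m ≤ A * Real.exp (D * m) / m.factorial * |R| ^ m := by gcongr
    _ = _ := by rw [mul_comm D]; ring

/-- The main sum is the Poisson expectation of Newton's interpolation polynomial. -/
lemma hasSum_poisson_newtonPoly (φ : ℝ → ℝ) (N : ℕ) (R : ℝ) :
    HasSum (fun m : ℕ => Real.exp (-R) * (R ^ m / (m.factorial : ℝ)) *
      (newtonPoly φ N R).eval (m : ℝ))
      (∑ s ∈ Finset.range (N + 1),
        ((fwdDiff (1 : ℝ))^[s] φ R) / (s.factorial : ℝ) * tau s (-R)) := by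
  refine (hasSum_sum fun s _ => (hasSum_poisson_choose R s).mul_left
    ((fwdDiff (1 : ℝ))^[s] φ R)).of_forall_eq (fun m => ?_)
    (Finset.sum_congr rfl fun s _ => by ring)
  rw [eval_newtonPoly, Finset.mul_sum]
  exact Finset.sum_congr rfl fun s _ => by ring

/-- The range `m ≥ T` is paid for by the exponential moment; below `T` there are only `⌈T⌉₊` terms,
each at most `δ`. -/
lemma poisson_error_le {φ P : ℕ → ℝ} {R T a k δ S : ℝ} (hR : 0 < R) (ha : 0 ≤ a)
    (haR : a ≤ √R) (hk : 0 ≤ k)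
    (hφ : Summable fun m : ℕ => φ m / (m.factorial : ℝ) * R ^ m)
    (hP : HasSum (fun m : ℕ => Real.exp (-R) * (R ^ m / (m.factorial : ℝ)) * P m) S)
    (hfar : ∀ m : ℕ, T ≤ m → |φ m - P m| ≤ k * Real.exp (a * (|(m : ℝ) - R| / √R)))
    (hnear : ∀ m : ℕ, m < T →
      Real.exp (-R) * (R ^ m / (m.factorial : ℝ)) * |φ m - P m| ≤ δ) :
    |Real.exp (-R) * (∑' m : ℕ, φ m / (m.factorial : ℝ) * R ^ m) - S| ≤
      k * (2 * Real.exp (a ^ 2)) + ⌈T⌉₊ * δ := by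
  have h1 : HasSum (fun m : ℕ => Real.exp (-R) * (R ^ m / (m.factorial : ℝ)) * φ m)
      (Real.exp (-R) * ∑' m : ℕ, φ m / (m.factorial : ℝ) * R ^ m) :=
    (hφ.hasSum.mul_left (Real.exp (-R))).of_forall_eq (fun m => by ring) rfl
  obtain ⟨hsum, hle⟩ := poisson_exp_abs hR ha haR
  have h2 : HasSum (fun m : ℕ => if m ∈ Finset.range ⌈T⌉₊ then δ else 0)
      (⌈T⌉₊ * δ) := by
    refine (hasSum_sum_of_ne_finset_zero (s := Finset.range ⌈T⌉₊)
      (fun m hm => if_neg hm)).of_forall_eq (fun _ => rfl) ?_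
    rw [Finset.sum_ite_mem, Finset.inter_self, Finset.sum_const, Finset.card_range, nsmul_eq_mul]
  have h3 := tsum_of_norm_bounded ((hsum.hasSum.mul_left k).add h2)
    (f := fun m : ℕ => Real.exp (-R) * (R ^ m / (m.factorial : ℝ)) * φ m -
      Real.exp (-R) * (R ^ m / (m.factorial : ℝ)) * P m) (fun m => by
      have hp : 0 ≤ Real.exp (-R) * (R ^ m / (m.factorial : ℝ)) := by positivity
      rw [← mul_sub, Real.norm_eq_abs, abs_mul, abs_of_nonneg hp]
      by_cases hm : (m : ℝ) < T
      · rw [if_pos (Finset.mem_range.2 (Nat.lt_ceil.2 hm))]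
        have : 0 ≤ k * (Real.exp (-R) * (R ^ m / (m.factorial : ℝ)) *
          Real.exp (a * (|(m : ℝ) - R| / √R))) := by positivity
        linarith [hnear m hm]
      · rw [if_neg (by rwa [Finset.mem_range, Nat.lt_ceil]), add_zero]
        calc _ ≤ Real.exp (-R) * (R ^ m / (m.factorial : ℝ)) *
              (k * Real.exp (a * (|(m : ℝ) - R| / √R))) := by
              gcongr
              exact hfar m (not_lt.1 hm)
          _ = _ := by ring)
  rw [(h1.sub hP).tsum_eq, Real.norm_eq_abs] at h3
  refine h3.trans ?_
  gcongr

lemma iteratedDeriv_eq_iteratedDerivWithin_Ici (f : ℝ → ℝ) (n : ℕ) {x : ℝ} (hx : 0 < x) :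
    iteratedDerivWithin n f (Ici 0) x = iteratedDeriv n f x := by
  rw [← iteratedDerivWithin_univ]
  simp only [iteratedDerivWithin]
  rw [iteratedFDerivWithin_congr_set]
  exact eventuallyEq_univ.2 (Ici_mem_nhds hx)

theorem theorem5 (N : ℕ) (B C : ℝ) (hB : 0 < B) (hC : 0 < C) :
    ∃ K : ℝ, 0 < K ∧
      ∀ (T : ℝ), 0 < T → ∀ (φ G : ℝ → ℝ),
        ContDiffOn ℝ ((N + 1 : ℕ) : WithTop ℕ∞) φ (Ici 0) →
        (∀ x : ℝ, T ≤ x → 0 < G x) →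
        (∀ x : ℝ, T ≤ x →
          |iteratedDerivWithin (N + 1) φ (Ici 0) x| ≤ G x / x ^ (N + 1)) →
        (∀ x y : ℝ, T ≤ x → T ≤ y →
          G y ≤ B * G x * Real.exp (C * (|y - x| / √x))) →
        (∀ R : ℝ, Summable fun m : ℕ => φ (m : ℝ) / (m.factorial : ℝ) * R ^ m) ∧
        ∀ᶠ R : ℝ in atTop,
          |Real.exp (-R) * (∑' m : ℕ, φ (m : ℝ) / (m.factorial : ℝ) * R ^ m)
              - ∑ s ∈ Finset.range (N + 1),
                  ((fwdDiff (1 : ℝ))^[s] φ R) / (s.factorial : ℝ) * tau s (-R)|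
            ≤ K * (R ^ (-(((N : ℝ) + 1) / 2)) * G R)
              + K * (R ^ (T + ((N : ℝ) + 1) / 2) * Real.exp (-R)) := by
  set K₀ := B * 2 ^ (N + 1) * Real.exp (N + 1 + C * N) with hK₀
  have hK₀pos : 0 < K₀ := by positivity
  -- The summand `1` covers the terms `m < T` in both error terms.
  refine ⟨K₀ * (2 * Real.exp ((2 + C) ^ 2)) + 1, by positivity,
    fun T hT φ G hφ₀ hG hd₀ hGG => ?_⟩
  have hφ : ContDiffOn ℝ ((N + 1 : ℕ) : WithTop ℕ∞) φ (Ioi 0) := hφ₀.mono Ioi_subset_Ici_self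
  have hd : ∀ x : ℝ, T ≤ x → |iteratedDeriv (N + 1) φ x| ≤ G x / x ^ (N + 1) := fun x hx => by
    rw [← iteratedDeriv_eq_iteratedDerivWithin_Ici φ _ (hT.trans_le hx)]
    exact hd₀ x hx
  obtain ⟨A, D, hAD⟩ := exists_exp_bound hB hC hT hφ hG hd hGG
  have hsum := summable_of_exp_bound hAD
  refine ⟨hsum, ?_⟩
  obtain ⟨A', hA', hleft⟩ := newton_error_left_le hB hC hT hφ hG hd hGG
  set Q := newtonPoly φ N T
  set A₀ := ∑ m ∈ Finset.range ⌈T⌉₊, |φ m - Q.eval (m : ℝ)| with hA₀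
  have hA₀le : ∀ m : ℕ, m < T → |φ m - Q.eval (m : ℝ)| ≤ A₀ := fun m hm =>
    Finset.single_le_sum (f := fun m : ℕ => |φ m - Q.eval (m : ℝ)|)
      (fun _ _ => abs_nonneg _) (Finset.mem_range.2 (Nat.lt_ceil.2 hm))
  have hpos : 0 < ((N : ℝ) + 1) / 2 := by positivity
  -- The spare power `R^((N+1)/2)` in the second error term absorbs the dependence on `φ` and `T`,
  -- keeping `K` uniform.
  have e1 : ∀ᶠ R : ℝ in atTop, ⌈T⌉₊ * A₀ ≤ R ^ (((N : ℝ) + 1) / 2) :=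
    (tendsto_rpow_atTop hpos).eventually_ge_atTop _
  have e2 := eventually_rpow_mul_exp_le_one (⌈T⌉₊ * A')
    (T + ((2 * N + 1 : ℕ) : ℝ) + ((N : ℝ) + 1) / 2) (2 + C) (by positivity)
  have e3 : ∀ᶠ R : ℝ in atTop, (R / T) ^ (N + 1) ≤ Real.exp (√R / 2) := by
    have h := (tendsto_rpow_mul_exp_neg_mul_atTop_nhds_zero
      (((2 * (N + 1) : ℕ) : ℝ)) (1 / 2) (by norm_num)).comp Real.tendsto_sqrt_atTop
    filter_upwards [h.eventually_le_const (show 0 < T ^ (N + 1) by positivity),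
      eventually_ge_atTop 0] with R h1 h2
    rw [Function.comp, Real.rpow_natCast, pow_mul, Real.sq_sqrt h2, neg_mul, Real.exp_neg,
      mul_inv_le_iff₀ (Real.exp_pos _)] at h1
    rw [div_pow, div_le_iff₀ (by positivity), mul_comm]
    rwa [show √R / 2 = 1 / 2 * √R by ring]
  filter_upwards [e1, e2, e3, eventually_ge_atTop T, eventually_ge_atTop 1,
    eventually_ge_atTop ((2 + C) ^ 2)] with R h1 h2 h3 hTR hR1 hCR
  have hR0 : 0 < R := by linarith
  have hGR := hG R hTR
  have hsqrt : (√R ^ (N + 1))⁻¹ = R ^ (-(((N : ℝ) + 1) / 2)) := by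
    rw [Real.rpow_neg hR0.le, Real.sqrt_eq_rpow, ← Real.rpow_natCast, ← Real.rpow_mul hR0.le]
    push_cast
    ring_nf
  set W := R ^ (2 * N + 1) * Real.exp ((2 + C) * √R) * G R with hW
  have hmain := poisson_error_le (φ := fun m : ℕ => φ m)
    (P := fun m : ℕ => (newtonPoly φ N R).eval (m : ℝ)) (T := T) (a := 2 + C)
    (k := K₀ * ((√R ^ (N + 1))⁻¹ * G R)) (δ := Real.exp (-R) * R ^ T * (A₀ + A' * W))
    hR0 (by positivity) (Real.le_sqrt_of_sq_le hCR) (by positivity) (hsum R)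
    (hasSum_poisson_newtonPoly φ N R)
    (fun m hm => newton_error_near_le hB hC hT hφ hG hd hGG hm hTR hR1 h3)
    (fun m hm => by
      have hp : R ^ m / (m.factorial : ℝ) ≤ R ^ T := by
        refine (div_le_self (by positivity) (by exact_mod_cast m.factorial_pos)).trans ?_
        rw [← Real.rpow_natCast]
        exact Real.rpow_le_rpow_of_exponent_le hR1 hm.le
      have he := (hleft R hTR hR1 m m.cast_nonneg (hm.le.trans hTR)).trans
        (add_le_add_left (hA₀le m hm) _)
      gcongr)
  refine hmain.trans ?_
  rw [hsqrt]
  set X := R ^ (-(((N : ℝ) + 1) / 2)) * G R with hX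
  set Y := R ^ (T + ((N : ℝ) + 1) / 2) * Real.exp (-R) with hY
  have hX0 : 0 < X := by positivity
  have hY0 : 0 < Y := by positivity
  have b1 : Real.exp (-R) * R ^ T * (⌈T⌉₊ * A₀) ≤ Y := by
    rw [hY, Real.rpow_add hR0]
    calc _ ≤ Real.exp (-R) * R ^ T * R ^ (((N : ℝ) + 1) / 2) := by gcongr
      _ = _ := by ring
  have b2 : Real.exp (-R) * R ^ T * (⌈T⌉₊ * (A' * W)) ≤ X := by
    rw [Real.rpow_add hR0, Real.rpow_add hR0, Real.rpow_natCast] at h2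
    have hc : R ^ (((N : ℝ) + 1) / 2) * R ^ (-(((N : ℝ) + 1) / 2)) = 1 := by
      rw [← Real.rpow_add hR0, add_neg_cancel, Real.rpow_zero]
    calc _ = (⌈T⌉₊ * A' * (R ^ T * R ^ (2 * N + 1) * R ^ (((N : ℝ) + 1) / 2) *
          Real.exp ((2 + C) * √R) * Real.exp (-R))) * X := by
          rw [hW, hX]
          linear_combination (-(⌈T⌉₊ * A' * R ^ T * R ^ (2 * N + 1) *
            Real.exp ((2 + C) * √R) * Real.exp (-R) * G R)) * hc
      _ ≤ 1 * X := by gcongr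
      _ = X := one_mul X
  have b3 : 0 ≤ K₀ * (2 * Real.exp ((2 + C) ^ 2)) * Y := by positivity
  linarith
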